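/- Let $G$ be an uncountable Polish group and let $P(G)$ be the space of all Borel probability measures on $G$, equipped with the weak* topology (the topology of weak convergence of measures). A universally measurable set $A\subseteq G$ (one that is measurable with respect to the completion of every $\sigma$-finite Borel measure on $G$) is called generically left Haar-null if the set $$T_l(A)=\{\mu\in P(G) : \mu(gA)=0 \text{ for all } g\in G\}$$ is co-meager in $P(G)$, where $\mu$ also denotes the completion of $\mu$. If $H$ is an analytic subgroup of $G$ with empty interior, then $H$ is generically left Haar-null (in particular, $H$ is universally measurable). -/

import Mathlib

open MeasureTheory
open scoped Pointwise

/-- A subset of a measurable space (in the theorem: a Polish space with its Borel `σ`-algebra)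
is universally measurable if it is measurable for the completion of every `σ`-finite measure. -/
def IsUniversallyMeasurable {X : Type*} [MeasurableSpace X] (A : Set X) : Prop :=
  ∀ μ : Measure X, SigmaFinite μ → NullMeasurableSet A μ

/-- `T_l(A)`: the Borel probability measures that vanish on all left translates `gA` of `A`.
On a set that is null-measurable for `μ`, the value of `μ` is that of the completion of `μ`. -/
def leftNullMeasures {G : Type*} [Group G] [MeasurableSpace G] (A : Set G) :
    Set (ProbabilityMeasure G) :=
  {μ | ∀ g : G, (μ : Measure G) (g • A) = 0}

/-- A universally measurable set `A` is generically left Haar-null if `T_l(A)` is co-meager in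
the space of Borel probability measures, with the topology of weak convergence. -/
def IsGenericallyLeftHaarNull {G : Type*} [Group G] [TopologicalSpace G] [MeasurableSpace G]
    [BorelSpace G] (A : Set G) : Prop :=
  IsUniversallyMeasurable A ∧ leftNullMeasures A ∈ residual (ProbabilityMeasure G)

/-!
The subgroup `H` has the property of Baire and is measurable for every `σ`-finite measure, because
both properties are preserved by Suslin's operation. By Pettis' theorem, a subgroup with the
property of Baire and with empty interior is meager.

For meager `H`, cover `H` by nowhere dense closed sets `F`. The relation `x⁻¹ * y ∈ F` is closed and
has nowhere dense sections, so any measure can be approximated by uniform averages of `N` laws with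
countable supports, where distinct atoms, of the same or of different laws, are chosen unrelated.
The square of such an average gives the relation mass at most `1 / N`. Hence
`(μ × μ) {(x, y) | x⁻¹ * y ∈ F} < ε` is an open dense condition on `μ`, and for generic `μ` the set
`{(x, y) | x⁻¹ * y ∈ H}` is null for `μ × μ`. It contains the square of every coset `gH`, so
`μ (gH) = 0`.
-/

open Set Filter Topology

section Suslin

variable {X : Type*}

/-- `B` is an envelope of `s` modulo the `σ`-ideal dual to the filter `l`: up to the ideal, `B` is
the smallest measurable set containing `s`. The inclusion of `s` in `B` is also only required up to
the ideal. -/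
structure IsEnvelope [MeasurableSpace X] (l : Filter X) (s B : Set X) : Prop where
  measurableSet : MeasurableSet B
  eventuallyLE : s ≤ᶠ[l] B
  eventuallyLE_of_measurableSet : ∀ ⦃C⦄, MeasurableSet C → s ≤ᶠ[l] C → B ≤ᶠ[l] C

theorem IsEnvelope.inter_closure [TopologicalSpace X] [MeasurableSpace X] [OpensMeasurableSpace X]
    {l : Filter X} {s B : Set X} (h : IsEnvelope l s B) : IsEnvelope l s (B ∩ closure s) where
  measurableSet := h.measurableSet.inter isClosed_closure.measurableSet
  eventuallyLE := h.eventuallyLE.mono fun _ hB hs => ⟨hB hs, subset_closure hs⟩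
  eventuallyLE_of_measurableSet _ hC hsC :=
    (h.eventuallyLE_of_measurableSet hC hsC).mono fun _ hBC hB => hBC hB.1

theorem exists_forall_res_of_forall_exists_cons {α : Type*} {P : List α → Prop} (h_nil : P [])
    (h_cons : ∀ u, P u → ∃ a, P (a :: u)) : ∃ z : ℕ → α, ∀ n, P (PiNat.res z n) := by
  choose g hg using fun u : {u // P u} => h_cons u u.2
  let b : ℕ → {u // P u} := fun n => Nat.rec ⟨[], h_nil⟩ (fun _ u => ⟨g u :: u.1, hg u⟩) n
  have hb : ∀ n, PiNat.res (fun n => g (b n)) n = (b n).1 := by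
    intro n
    induction n with
    | zero => rfl
    | succ n ih => rw [PiNat.res_succ, ih]
  exact ⟨fun n => g (b n), fun n => hb n ▸ (b n).2⟩

theorem eq_of_forall_mem_closure_image_cylinder [TopologicalSpace X] [T2Space X]
    {f : (ℕ → ℕ) → X} {z : ℕ → ℕ} (hf : ContinuousAt f z) {x : X}
    (hx : ∀ n, x ∈ closure (f '' PiNat.cylinder z n)) : x = f z := by
  have hbasis : (𝓝 z).HasBasis (fun _ => True) (PiNat.cylinder z) := by
    refine ⟨fun t => ⟨fun ht => ?_, fun ⟨n, _, hn⟩ =>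
      mem_of_superset ((PiNat.isOpen_cylinder _ z n).mem_nhds (PiNat.self_mem_cylinder z n)) hn⟩⟩
    obtain ⟨_, ⟨y, n, rfl⟩, hzy, hyt⟩ :=
      (PiNat.isTopologicalBasis_cylinders _).mem_nhds_iff.1 ht
    exact ⟨n, trivial, PiNat.mem_cylinder_iff_eq.1 hzy ▸ hyt⟩
  have hcluster : ClusterPt x (map f (𝓝 z)) :=
    (hbasis.map f).clusterPt_iff_forall_mem_closure.2 fun n _ => hx n
  exact eq_of_nhds_neBot (hcluster.mono hf)

theorem eventuallyMeasurableSet_of_analyticSet [TopologicalSpace X] [T2Space X]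
    [m : MeasurableSpace X] [OpensMeasurableSpace X] (l : Filter X) [CountableInterFilter l]
    (h_env : ∀ s, ∃ B, IsEnvelope l s B) {A : Set X} (hA : AnalyticSet A) :
    EventuallyMeasurableSet m l A := by
  rw [AnalyticSet] at hA
  obtain rfl | ⟨f, hf, rfl⟩ := hA
  · exact MeasurableSet.empty.eventuallyMeasurableSet
  -- the image of the cylinder of the finite sequence `u`, which is read backwards as in `PiNat.res`
  let S : List ℕ → Set X := fun u => f '' {x | PiNat.res x u.length = u}
  have h_env_closure : ∀ u, ∃ B, IsEnvelope l (S u) B ∧ B ⊆ closure (S u) := fun u =>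
    (h_env (S u)).elim fun B h => ⟨B ∩ closure (S u), h.inter_closure, inter_subset_right⟩
  choose B hB hB_closure using h_env_closure
  have hS_nil : S [] = range f := by simp [S]
  have hS_cons : ∀ u, S u ⊆ ⋃ n, S (n :: u) := by
    rintro u _ ⟨x, hx, rfl⟩
    exact mem_iUnion.2 ⟨x u.length, x, by simpa using hx, rfl⟩
  have hS_le : ∀ u, S u ≤ᶠ[l] ⋃ n, B (n :: u) := fun u =>
    (hS_cons u).eventuallyLE.trans (.countable_iUnion fun n => (hB _).eventuallyLE)
  have hB_le : ∀ u, B u ≤ᶠ[l] ⋃ n, B (n :: u) := fun u =>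
    (hB u).eventuallyLE_of_measurableSet (.iUnion fun n => (hB _).measurableSet) (hS_le u)
  refine ⟨B [], (hB []).measurableSet, ?_⟩
  filter_upwards [(hB []).eventuallyLE, eventually_countable_forall.2 hB_le] with x hx_nil hx_cons
  refine propext ⟨fun hx => hx_nil (hS_nil ▸ hx), fun hx => ?_⟩
  obtain ⟨z, hz⟩ := exists_forall_res_of_forall_exists_cons (P := fun u => x ∈ B u) hx
    fun u hu => mem_iUnion.1 (hx_cons u hu)
  refine ⟨z, (eq_of_forall_mem_closure_image_cylinder hf.continuousAt fun n => ?_).symm⟩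
  simpa only [S, PiNat.cylinder_eq_res, PiNat.res_length] using hB_closure _ (hz n)

theorem isEnvelope_toMeasurable [MeasurableSpace X] (μ : Measure X) [SFinite μ] (s : Set X) :
    IsEnvelope (ae μ) s (toMeasurable μ s) where
  measurableSet := measurableSet_toMeasurable μ s
  eventuallyLE := (subset_toMeasurable μ s).eventuallyLE
  eventuallyLE_of_measurableSet C hC hsC := by
    rw [ae_le_set, sdiff_eq] at hsC ⊢
    rwa [Measure.measure_toMeasurable_inter_of_sFinite hC.compl]

theorem nullMeasurableSet_of_analyticSet [TopologicalSpace X] [T2Space X] [MeasurableSpace X]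
    [OpensMeasurableSpace X] (μ : Measure X) [SFinite μ] {A : Set X} (hA : AnalyticSet A) :
    NullMeasurableSet A μ :=
  eventuallyMeasurableSet_of_analyticSet (ae μ) (fun s => ⟨_, isEnvelope_toMeasurable μ s⟩) hA

variable [TopologicalSpace X]

/-- The largest open set in which `s` is meager, when the topology is second countable. Its
complement is the envelope of `s` modulo meager sets. -/
def meagreLocus (s : Set X) : Set X := ⋃₀ {V | IsOpen V ∧ IsMeagre (s ∩ V)}

theorem isOpen_meagreLocus (s : Set X) : IsOpen (meagreLocus s) :=
  isOpen_sUnion fun _ hV => hV.1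

theorem isMeagre_inter_meagreLocus [SecondCountableTopology X] (s : Set X) :
    IsMeagre (s ∩ meagreLocus s) := by
  obtain ⟨T, hT, hTs, hT_eq⟩ := TopologicalSpace.isOpen_sUnion_countable
    {V | IsOpen V ∧ IsMeagre (s ∩ V)} fun _ hV => hV.1
  rw [meagreLocus, ← hT_eq, sUnion_eq_biUnion, inter_iUnion₂]
  exact isMeagre_biUnion hT fun V hV => (hTs hV).2

theorem isEnvelope_compl_meagreLocus [SecondCountableTopology X] [MeasurableSpace X] [BorelSpace X]
    (s : Set X) : IsEnvelope (residual X) s (meagreLocus s)ᶜ where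
  measurableSet := (isOpen_meagreLocus s).measurableSet.compl
  eventuallyLE := by
    filter_upwards [isMeagre_inter_meagreLocus s] with x hx hxs hxU using hx ⟨hxs, hxU⟩
  eventuallyLE_of_measurableSet C hC hsC := by
    obtain ⟨W, hW, hCW⟩ := hC.compl.residualEq_isOpen
    have hsW : IsMeagre (s ∩ W) := by
      filter_upwards [hCW.mem_iff, hsC] with x hxW hxC hx using hxW.2 hx.2 (hxC hx.1)
    have hW_sub : W ⊆ meagreLocus s := subset_sUnion_of_mem ⟨hW, hsW⟩
    filter_upwards [hCW.mem_iff] with x hxW hxU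
    exact not_not.1 fun hxC => hxU (hW_sub (hxW.1 hxC))

theorem baireMeasurableSet_of_analyticSet [T2Space X] [SecondCountableTopology X] {A : Set X}
    (hA : AnalyticSet A) : BaireMeasurableSet A := by
  borelize X
  exact eventuallyMeasurableSet_of_analyticSet (residual X)
    (fun s => ⟨_, isEnvelope_compl_meagreLocus s⟩) hA

end Suslin

section Pettis

variable {G : Type*} [Group G] [TopologicalSpace G] [IsTopologicalGroup G] [BaireSpace G]

theorem div_mem_nhds_one_of_not_isMeagre {A : Set G} (hA : BaireMeasurableSet A)
    (hA_meagre : ¬IsMeagre A) : A / A ∈ 𝓝 (1 : G) := by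
  obtain ⟨W, hW, hAW⟩ := hA.residualEq_isOpen
  have hW_nonempty : W.Nonempty := by
    rw [nonempty_iff_ne_empty]
    rintro rfl
    exact hA_meagre (hAW.mem_iff.mono fun x hx => by simpa using hx)
  obtain ⟨w, hw⟩ := hW_nonempty
  have hN : ∀ᶠ g in 𝓝 (1 : G), g * w ∈ W :=
    (hW.preimage (continuous_mul_const w)).mem_nhds (by simpa using hw)
  filter_upwards [hN] with g hg
  have hgAW : ∀ᶠ x in residual G, g⁻¹ * x ∈ A ↔ g⁻¹ * x ∈ W :=
    (tendsto_residual_of_isOpenMap (continuous_const_mul g⁻¹) (isOpenMap_mul_left g⁻¹)).eventually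
      hAW.mem_iff
  obtain ⟨x, ⟨hxW, hgxW⟩, hxA, hgxA⟩ :=
    (dense_of_mem_residual (hAW.mem_iff.and hgAW)).inter_open_nonempty
      (W ∩ (g⁻¹ * ·) ⁻¹' W) (hW.inter (hW.preimage (continuous_const_mul _)))
      ⟨g * w, hg, by simpa using hw⟩
  exact ⟨x, hxA.2 hxW, g⁻¹ * x, hgxA.2 hgxW, by simp⟩

theorem isMeagre_subgroup_of_interior_eq_empty {H : Subgroup G}
    (hH : BaireMeasurableSet (H : Set G)) (hint : interior (H : Set G) = ∅) :
    IsMeagre (H : Set G) := by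
  by_contra hH_meagre
  have hH_nhds := div_mem_nhds_one_of_not_isMeagre hH hH_meagre
  have hHH : (H : Set G) / H = H := by simp [div_eq_mul_inv]
  rw [hHH] at hH_nhds
  exact (hint ▸ mem_interior_iff_mem_nhds.2 hH_nhds : (1 : G) ∈ (∅ : Set G))

end Pettis

section Selection

variable {X : Type*}

theorem exists_forall_mem_pairwise_of_forall_finite {ι : Type*} [Countable ι] {V : ι → Set X}
    {R : X → X → Prop}
    (h : ∀ i (s : Set X), s.Finite → ∃ y ∈ V i, ∀ x ∈ s, R x y ∧ R y x) :
    ∃ y : ι → X, (∀ i, y i ∈ V i) ∧ Pairwise fun i j => R (y i) (y j) := by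
  choose g hgV hgR using h
  obtain ⟨k, hk⟩ := exists_injective_nat ι
  have hfin : ∀ i, Finite {j // k j < k i} := fun i =>
    .of_injective (fun j => (⟨k j, j.2⟩ : Fin (k i))) fun j j' hjj' =>
      Subtype.ext (hk (Fin.mk.inj hjj'))
  let y : ι → X := (measure k).wf.fix fun i y =>
    g i (range fun j : {j // k j < k i} => y j j.2) (finite_range _)
  have hy : ∀ i, y i = g i (range fun j : {j // k j < k i} => y j) (finite_range _) := fun i =>
    WellFounded.fix_eq _ _ i
  have hR : ∀ i j, k i < k j → R (y i) (y j) ∧ R (y j) (y i) := fun i j hij => by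
    rw [hy j]
    exact hgR j _ _ _ ⟨⟨i, hij⟩, rfl⟩
  refine ⟨y, fun i => hy i ▸ hgV i _ _, fun i j hij => ?_⟩
  rcases (hk.ne hij).lt_or_gt with h | h
  exacts [(hR i j h).1, (hR j i h).2]

variable [TopologicalSpace X]

theorem exists_mem_forall_notMem_of_isNowhereDense {𝒮 : Set (Set X)} (h𝒮 : 𝒮.Finite)
    (hnd : ∀ s ∈ 𝒮, IsNowhereDense s) {V : Set X} (hV : IsOpen V) (hV_nonempty : V.Nonempty) :
    ∃ y ∈ V, ∀ s ∈ 𝒮, y ∉ s := by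
  have hdense : Dense (⋂₀ ((fun s => (closure s)ᶜ) '' 𝒮)) := by
    refine (h𝒮.image _).dense_sInter ?_ ?_
    · exact forall_mem_image.2 fun _ _ => isClosed_closure.isOpen_compl
    · exact forall_mem_image.2 fun s hs => interior_eq_empty_iff_dense_compl.1 (hnd s hs)
  obtain ⟨y, hyV, hy⟩ := hdense.inter_open_nonempty V hV hV_nonempty
  exact ⟨y, hyV, fun s hs hys => hy _ (mem_image_of_mem _ hs) (subset_closure hys)⟩

theorem exists_forall_mem_pairwise_notMem_of_isNowhereDense {ι : Type*} [Countable ι]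
    {E : Set (X × X)} (hE₁ : ∀ x, IsNowhereDense {y | (x, y) ∈ E})
    (hE₂ : ∀ x, IsNowhereDense {y | (y, x) ∈ E}) {V : ι → Set X} (hV : ∀ i, IsOpen (V i))
    (hV_nonempty : ∀ i, (V i).Nonempty) :
    ∃ y : ι → X, (∀ i, y i ∈ V i) ∧ Pairwise fun i j => (y i, y j) ∉ E := by
  refine exists_forall_mem_pairwise_of_forall_finite (R := fun x y => (x, y) ∉ E)
    fun i s hs => ?_
  obtain ⟨y, hyV, hy⟩ := exists_mem_forall_notMem_of_isNowhereDense
    ((hs.image fun x => {y | (x, y) ∈ E}).union (hs.image fun x => {y | (y, x) ∈ E}))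
    (by
      rintro _ (⟨x, -, rfl⟩ | ⟨x, -, rfl⟩)
      exacts [hE₁ x, hE₂ x]) (hV i) (hV_nonempty i)
  exact ⟨y, hyV, fun x hx => ⟨hy _ (.inl ⟨x, hx, rfl⟩), hy _ (.inr ⟨x, hx, rfl⟩)⟩⟩

end Selection

section GenericMeasure

variable {X : Type*} [MeasurableSpace X]

theorem prod_self_map_le_sum_sq {Ω ι : Type*} [MeasurableSpace Ω] [Fintype ι] (ρ : Measure Ω)
    [SFinite ρ] {f : Ω → X} (hf : Measurable f) (b : Ω → ι) {E : Set (X × X)}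
    (hE : MeasurableSet E) (hb : ∀ ω ω', (f ω, f ω') ∈ E → b ω = b ω') :
    ((ρ.map f).prod (ρ.map f)) E ≤ ∑ i, ρ (b ⁻¹' {i}) ^ 2 := by
  rw [Measure.map_prod_map _ _ hf hf, Measure.map_apply (hf.prodMap hf) hE]
  calc (ρ.prod ρ) (Prod.map f f ⁻¹' E)
      ≤ (ρ.prod ρ) (⋃ i, (b ⁻¹' {i}) ×ˢ (b ⁻¹' {i})) :=
        measure_mono fun p hp => mem_iUnion.2 ⟨b p.1, rfl, (hb _ _ hp).symm⟩
    _ ≤ ∑ i, (ρ.prod ρ) ((b ⁻¹' {i}) ×ˢ (b ⁻¹' {i})) := measure_iUnion_fintype_le _ _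
    _ = ∑ i, ρ (b ⁻¹' {i}) ^ 2 := by simp only [Measure.prod_prod, sq]

theorem tendsto_of_dist_le_nearestPtInd [PseudoMetricSpace X] [OpensMeasurableSpace X] {e : ℕ → X}
    (he : DenseRange e) {r : ℕ → ℝ} (hr : Tendsto r atTop (𝓝 0)) {y : ℕ → ℕ → X}
    (hy : ∀ k n, dist (y k n) (e n) ≤ r k) (x : X) :
    Tendsto (fun k => y k (SimpleFunc.nearestPtInd e k x)) atTop (𝓝 x) := by
  have h_nearest : Tendsto (fun k => SimpleFunc.nearestPt e k x) atTop (𝓝 x) :=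
    SimpleFunc.tendsto_nearestPt (he x)
  exact (tendsto_iff_of_dist (squeeze_zero (fun _ => dist_nonneg) (fun k => hy k _) hr)).2 h_nearest

variable [TopologicalSpace X]

theorem isOpen_setOf_measure_lt_of_isClosed [OpensMeasurableSpace X] [HasOuterApproxClosed X]
    {F : Set X} (hF : IsClosed F) (c : ENNReal) :
    IsOpen {μ : ProbabilityMeasure X | (μ : Measure X) F < c} :=
  isOpen_iff_mem_nhds.2 fun _ hμ => eventually_lt_of_limsup_lt
    ((ProbabilityMeasure.limsup_measure_closed_le_of_tendsto tendsto_id hF).trans_lt hμ)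

variable [TopologicalSpace.PseudoMetrizableSpace X] [SecondCountableTopology X] [BorelSpace X]
  {E : Set (X × X)}

theorem exists_seq_measurable_tendsto_fst_of_isNowhereDense {ι : Type*} [Countable ι]
    [MeasurableSpace ι] [MeasurableSingletonClass ι]
    (hE₁ : ∀ x, IsNowhereDense {y | (x, y) ∈ E}) (hE₂ : ∀ x, IsNowhereDense {y | (y, x) ∈ E}) :
    ∃ f : ℕ → X × ι → X, (∀ k, Measurable (f k)) ∧
      (∀ p, Tendsto (fun k => f k p) atTop (𝓝 p.1)) ∧
      ∀ k p q, (f k p, f k q) ∈ E → p.2 = q.2 := by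
  obtain _ | _ := isEmpty_or_nonempty X
  · exact ⟨fun _ => Prod.fst, fun _ => measurable_fst, fun p => isEmptyElim p.1,
      fun _ p => isEmptyElim p.1⟩
  let := TopologicalSpace.pseudoMetrizableSpacePseudoMetric X
  let e := TopologicalSpace.denseSeq X
  have h_points : ∀ k : ℕ, ∃ y : ℕ × ι → X,
      (∀ p, y p ∈ Metric.ball (e p.1) (1 / (k + 1 : ℝ))) ∧ Pairwise fun p q => (y p, y q) ∉ E :=
    fun k => exists_forall_mem_pairwise_notMem_of_isNowhereDense hE₁ hE₂
      (fun _ => Metric.isOpen_ball) fun _ => Metric.nonempty_ball.2 Nat.one_div_pos_of_nat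
  choose y hye hyE using h_points
  refine ⟨fun k p => y k (SimpleFunc.nearestPtInd e k p.1, p.2), fun k => ?_, fun p => ?_,
    fun k p q hpq => ?_⟩
  · exact (measurable_of_countable (y k)).comp
      (((SimpleFunc.nearestPtInd e k).measurable.comp measurable_fst).prodMk measurable_snd)
  · exact tendsto_of_dist_le_nearestPtInd (TopologicalSpace.denseRange_denseSeq X)
      tendsto_one_div_add_atTop_nhds_zero_nat (y := fun k n => y k (n, p.2))
      (fun k n => (hye k (n, p.2)).le) p.1
  · by_contra hne
    exact hyE k (fun heq => hne (Prod.mk.inj heq).2) hpq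

theorem dense_setOf_prod_self_le_inv (hE : MeasurableSet E)
    (hE₁ : ∀ x, IsNowhereDense {y | (x, y) ∈ E}) (hE₂ : ∀ x, IsNowhereDense {y | (y, x) ∈ E})
    (N : ℕ) [NeZero N] :
    Dense {μ : ProbabilityMeasure X | (μ.prod μ : Measure (X × X)) E ≤ (N : ENNReal)⁻¹} := by
  intro μ
  obtain ⟨f, hf, hf_tendsto, hfE⟩ :=
    exists_seq_measurable_tendsto_fst_of_isNowhereDense (ι := Fin N) hE₁ hE₂
  let u : ProbabilityMeasure (Fin N) := ⟨ProbabilityTheory.uniformOn univ, inferInstance⟩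
  have hu : ∀ i, (μ.prod u : Measure (X × Fin N)) (Prod.snd ⁻¹' {i}) = (N : ENNReal)⁻¹ := by
    intro i
    rw [← univ_prod, ProbabilityMeasure.toMeasure_prod, Measure.prod_prod]
    simp [u, ProbabilityTheory.uniformOn_univ]
  have h_laws : Tendsto (fun k => (μ.prod u).map (hf k).aemeasurable) atTop (𝓝 μ) := by
    have h : Tendsto _ _ (𝓝 ((μ.prod u).map measurable_fst.aemeasurable)) :=
      (tendstoInDistribution_of_ae_tendsto (μ' := (μ.prod u : Measure (X × Fin N)))
        (fun k => (hf k).aemeasurable) measurable_fst.aemeasurable (.of_forall hf_tendsto)).tendsto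
    rw [ProbabilityMeasure.map_fst_prod] at h
    exact h
  refine mem_closure_of_tendsto h_laws (.of_forall fun k => ?_)
  -- Two independent samples can only be related if they carry the same `i : Fin N`.
  calc _ ≤ ∑ i, (μ.prod u : Measure (X × Fin N)) (Prod.snd ⁻¹' {i}) ^ 2 :=
        prod_self_map_le_sum_sq _ (hf k) Prod.snd hE (hfE k)
    _ = (N : ENNReal)⁻¹ := by
        simp only [hu, Finset.sum_const, Finset.card_univ, Fintype.card_fin, nsmul_eq_mul, sq]
        rw [← mul_assoc, ENNReal.mul_inv_cancel (by simp [NeZero.ne N]) (by finiteness), one_mul]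

theorem dense_setOf_prod_self_lt (hE : MeasurableSet E)
    (hE₁ : ∀ x, IsNowhereDense {y | (x, y) ∈ E}) (hE₂ : ∀ x, IsNowhereDense {y | (y, x) ∈ E})
    {c : ENNReal} (hc : c ≠ 0) :
    Dense {μ : ProbabilityMeasure X | (μ.prod μ : Measure (X × X)) E < c} := by
  obtain ⟨N, hN⟩ := ENNReal.exists_inv_nat_lt hc
  have : NeZero N := ⟨by rintro rfl; simp at hN⟩
  exact (dense_setOf_prod_self_le_inv hE hE₁ hE₂ N).mono fun μ hμ => lt_of_le_of_lt hμ hN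

theorem eventually_residual_prod_self_eq_zero (hE : IsClosed E)
    (hE₁ : ∀ x, IsNowhereDense {y | (x, y) ∈ E}) (hE₂ : ∀ x, IsNowhereDense {y | (y, x) ∈ E}) :
    ∀ᶠ μ : ProbabilityMeasure X in residual (ProbabilityMeasure X),
      (μ.prod μ : Measure (X × X)) E = 0 := by
  have h_lt : ∀ n : ℕ, ∀ᶠ μ : ProbabilityMeasure X in residual (ProbabilityMeasure X),
      (μ.prod μ : Measure (X × X)) E < (n : ENNReal)⁻¹ := fun n =>
    residual_of_dense_open
      ((isOpen_setOf_measure_lt_of_isClosed hE _).preimage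
        (ProbabilityMeasure.continuous_prod.comp (continuous_id.prodMk continuous_id)))
      (dense_setOf_prod_self_lt hE.measurableSet hE₁ hE₂ (by simp))
  filter_upwards [eventually_countable_forall.2 h_lt] with μ hμ
  by_contra h_ne
  obtain ⟨n, hn⟩ := ENNReal.exists_inv_nat_lt h_ne
  exact (hμ n).not_gt hn

end GenericMeasure

section Group

theorem isNowhereDense_preimage_homeomorph {X Y : Type*} [TopologicalSpace X] [TopologicalSpace Y]
    (φ : X ≃ₜ Y) {s : Set Y} (hs : IsNowhereDense s) : IsNowhereDense (φ ⁻¹' s) := by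
  rw [IsNowhereDense, ← φ.preimage_closure, ← φ.preimage_interior, hs, preimage_empty]

variable {G : Type*} [Group G] [TopologicalSpace G] [IsTopologicalGroup G]
  [SecondCountableTopology G] [MeasurableSpace G] [BorelSpace G]

theorem eventually_residual_prod_self_inv_mul_mem_eq_zero {M : Set G} (hM : IsMeagre M) :
    ∀ᶠ μ : ProbabilityMeasure G in residual (ProbabilityMeasure G),
      (μ.prod μ : Measure (G × G)) {p | p.1⁻¹ * p.2 ∈ M} = 0 := by
  obtain ⟨𝒮, h𝒮_nd, h𝒮, hM𝒮⟩ := isMeagre_iff_countable_union_isNowhereDense.1 hM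
  have h_closure : ∀ F ∈ 𝒮, ∀ᶠ μ : ProbabilityMeasure G in residual (ProbabilityMeasure G),
      (μ.prod μ : Measure (G × G)) {p | p.1⁻¹ * p.2 ∈ closure F} = 0 := fun F hF =>
    eventually_residual_prod_self_eq_zero
      (isClosed_closure.preimage (continuous_fst.inv.mul continuous_snd))
      (fun x => isNowhereDense_preimage_homeomorph (Homeomorph.mulLeft x⁻¹) (h𝒮_nd F hF).closure)
      fun x => isNowhereDense_preimage_homeomorph ((Homeomorph.inv G).trans (Homeomorph.mulRight x))
        (h𝒮_nd F hF).closure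
  filter_upwards [(eventually_countable_ball h𝒮).2 h_closure] with μ hμ
  refine measure_mono_null (fun p hp => ?_) ((measure_biUnion_null_iff h𝒮).2 hμ)
  obtain ⟨F, hF, hpF⟩ := hM𝒮 hp
  exact mem_biUnion hF (subset_closure hpF)

theorem leftNullMeasures_mem_residual_of_isMeagre_inv_mul {A : Set G} (hA : IsMeagre (A⁻¹ * A)) :
    leftNullMeasures A ∈ residual (ProbabilityMeasure G) := by
  filter_upwards [eventually_residual_prod_self_inv_mul_mem_eq_zero hA] with μ hμ g
  have h_sub : (g • A) ×ˢ (g • A) ⊆ {p : G × G | p.1⁻¹ * p.2 ∈ A⁻¹ * A} := by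
    rintro ⟨_, _⟩ ⟨⟨a, ha, rfl⟩, ⟨b, hb, rfl⟩⟩
    exact ⟨a⁻¹, by simpa using ha, b, hb, by simp [mul_assoc]⟩
  have h_sq := measure_mono_null h_sub hμ
  rw [ProbabilityMeasure.toMeasure_prod, Measure.prod_prod] at h_sq
  exact mul_self_eq_zero.1 h_sq

theorem mainTheorem5_general [T2Space G] [BaireSpace G] (H : Subgroup G)
    (hH : AnalyticSet (H : Set G)) (hint : interior (H : Set G) = ∅) :
    IsGenericallyLeftHaarNull (H : Set G) := by
  refine ⟨fun μ _ => nullMeasurableSet_of_analyticSet μ hH,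
    leftNullMeasures_mem_residual_of_isMeagre_inv_mul ?_⟩
  have hHH : (H : Set G)⁻¹ * H = H := by simp
  rw [hHH]
  exact isMeagre_subgroup_of_interior_eq_empty (baireMeasurableSet_of_analyticSet hH) hint

end Group

theorem mainTheorem5 {G : Type*} [Group G] [TopologicalSpace G] [IsTopologicalGroup G]
    [PolishSpace G] [Uncountable G] [MeasurableSpace G] [BorelSpace G]
    (H : Subgroup G) (hH : AnalyticSet (H : Set G)) (hint : interior (H : Set G) = ∅) :
    IsGenericallyLeftHaarNull (H : Set G) :=
  mainTheorem5_general H hH hint
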